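/- Let $E$ be a finite-dimensional real vector space (i.e. $E\cong\mathbb R^n$) with an inner product $(\cdot,\cdot)$ and norm $|m|^2=(m,m)$. Let $\Omega\subset E$ be compact, let $\mathrm{Conv}(\Omega)$ be its convex hull, and let $\mu_0$ be a Borel probability measure on $\Omega$ (the a priori spin distribution). Let $(J_{x,y})_{x,y\in\mathbb Z^d}$ be real couplings with $J_{x,y}=J_{y,x}$ and $J_{x,x}=0$ for all $x,y$, with $\sum_{x}|J_{0,x}|<\infty$ and $\sum_{x}J_{x,y}=1$ for every $y$, that are invariant under the translations and the rotations of $\mathbb Z^d$ (rotations: the orthogonal integer matrices of determinant one). Let $\beta\ge 0$ and $h\in E$. For a finite $\Lambda\subset\mathbb Z^d$ and a spin configuration $S=(S_x)\in\Omega^{\mathbb Z^d}$ put $$\beta\mathscr H_\Lambda(S)=-\beta\sum_{\substack{\langle x,y\rangle\\ x\in\Lambda,\ y\in\mathbb Z^d}}J_{x,y}(S_x,S_y)-\sum_{x\in\Lambda}(h,S_x),$$ the first sum being over all unordered pairs of distinct sites at least one of which lies in $\Lambda$. The finite-volume Gibbs measure in $\Lambda$ with boundary condition $S_{\Lambda^c}$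 is the probability measure on $\Omega^\Lambda$ whose density with respect to the product measure $\mu_0^{\otimes\Lambda}$ is proportional to $e^{-\beta\mathscr H_\Lambda}$. An infinite-volume Gibbs measure is a probability measure on $\Omega^{\mathbb Z^d}$ that satisfies the DLR equations: for every finite $\Lambda$, it is unchanged when the spins in $\Lambda$ are resampled from the finite-volume Gibbs measure given the spins outside $\Lambda$. For $m,b\in E$ let $$G(b)=\log\int_\Omega e^{(b,S)}\,\mu_0(dS),\qquad S(m)=\inf_{b\in E}\{G(b)-(b,m)\}\in[-\infty,0],$$ $$\Phi_{\beta,h}(m)=-\frac\beta2|m|^2-(h,m)-S(m)\in(-\infty,+\infty].$$ **Theorem.** Let $\nu$ be an infinite-volume Gibbs measure for these $\beta$ and $h$ that is invariant under the translations and the rotations of $\mathbb Z^d$ (acting on the sites), let $\langle-\rangle$ denote its expectation, and let $m_\star=\langle S_0\rangle$ and $m_0=\sum_{x\in\mathbb Z^d}J_{0,x}S_x$. Then $$\Phi_{\beta,h}(m_\star)\le\inf_{m\in\mathrm{Conv}(\Omega)}\Phi_{\beta,h}(m)+\frac\beta2\bigl\{\langle(S_0,m_0)\rangle-|m_\star|^2\bigr\}.$$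 -/

import Mathlib

noncomputable section

namespace SpinModel

open MeasureTheory

/-- The sites of the hypercubic lattice `ℤ^d`. -/
abbrev Site (d : ℕ) : Type := Fin d → ℤ

/-- Couplings on `ℤ^d`: symmetric, vanishing on the diagonal, absolutely summable, and normalized
to have total strength one at every site. -/
structure IsNormalizedCoupling {d : ℕ} (J : Site d → Site d → ℝ) : Prop where
  symm : ∀ x y, J x y = J y x
  diag : ∀ x, J x x = 0
  summable_abs : Summable fun x => |J 0 x|
  hasSum_one : ∀ y, HasSum (fun x => J x y) 1

/-- Invariance of the couplings under lattice translations. -/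
def CouplingTranslationInvariant {d : ℕ} (J : Site d → Site d → ℝ) : Prop :=
  ∀ x y, J x y = J 0 (y - x)

/-- Invariance of the couplings under the rotations of the lattice `ℤ^d`, i.e. under the
orthogonal integer matrices of determinant one. -/
def CouplingRotationInvariant {d : ℕ} (J : Site d → Site d → ℝ) : Prop :=
  ∀ R ∈ Matrix.specialOrthogonalGroup (Fin d) ℤ, ∀ x y,
    J (Matrix.mulVec R x) (Matrix.mulVec R y) = J x y

/-- Spin configurations on `ℤ^d` with spins in `Ω`. -/
abbrev Config (d : ℕ) {E : Type*} (Ω : Set E) : Type _ := Site d → Ω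

/-- The configuration that equals `σ` in `Λ` and `η` outside `Λ`. -/
def glue {d : ℕ} {E : Type*} {Ω : Set E} (Λ : Finset (Site d)) (σ : Λ → Ω) (η : Config d Ω) :
    Config d Ω :=
  fun x => if hx : x ∈ Λ then σ ⟨x, hx⟩ else η x

section Spins

variable {E : Type*} [NormedAddCommGroup E] [InnerProductSpace ℝ E]

/-- The quantity `β ℋ_Λ(S)` in the finite volume `Λ`: the pair interaction is summed once over
every unordered pair of distinct sites, at least one of which lies in `Λ`. Pairs inside `Λ` occur
twice in the first double sum, which accounts for the factor `1 / 2` (`J` is symmetric). -/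
def hamiltonian {d : ℕ} {Ω : Set E} (J : Site d → Site d → ℝ) (β : ℝ) (h : E)
    (Λ : Finset (Site d)) (S : Config d Ω) : ℝ :=
  -β * ((1 / 2) * ∑ x ∈ Λ, ∑ y ∈ Λ.erase x, J x y * inner ℝ (S x : E) (S y : E)
      + ∑ x ∈ Λ, ∑' y : {y : Site d // y ∉ Λ}, J x y * inner ℝ (S x : E) (S y : E))
    - ∑ x ∈ Λ, inner ℝ h (S x : E)

/-- The finite-volume Gibbs measure in `Λ` with boundary condition `η`: the probability measure on
`Ω^Λ` with density `exp (-β ℋ_Λ) / Z_Λ` with respect to the product of the a priori measure. -/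
def finiteVolumeGibbs {d : ℕ} {Ω : Set E} [MeasurableSpace E] (μ₀ : Measure Ω)
    (J : Site d → Site d → ℝ) (β : ℝ) (h : E) (Λ : Finset (Site d)) (η : Config d Ω) :
    Measure (Λ → Ω) :=
  (Measure.pi fun _ : Λ => μ₀).tilted fun σ => -hamiltonian J β h Λ (glue Λ σ η)

/-- Infinite-volume Gibbs measures: probability measures on `Ω^(ℤ^d)` that satisfy the DLR
equations in every finite volume, i.e. resampling the spins in `Λ` from the finite-volume Gibbs
measure given the spins outside `Λ` does not change the measure. -/
structure IsGibbsMeasure {d : ℕ} {Ω : Set E} [MeasurableSpace E] (μ₀ : Measure Ω)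
    (J : Site d → Site d → ℝ) (β : ℝ) (h : E) (ν : Measure (Config d Ω)) : Prop where
  isProbabilityMeasure : IsProbabilityMeasure ν
  dlr : ∀ (Λ : Finset (Site d)) (A : Set (Config d Ω)), MeasurableSet A →
    ν A = ∫⁻ η, finiteVolumeGibbs μ₀ J β h Λ η {σ | glue Λ σ η ∈ A} ∂ν

/-- Invariance of a law on configurations under lattice translations. -/
def TranslationInvariant {d : ℕ} {Ω : Set E} [MeasurableSpace E] (ν : Measure (Config d Ω)) :
    Prop :=
  ∀ a : Site d, ν.map (fun S x => S (x + a)) = ν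

/-- Invariance of a law on configurations under the rotations of the lattice (which act on the
sites and not on the spin values). -/
def RotationInvariant {d : ℕ} {Ω : Set E} [MeasurableSpace E] (ν : Measure (Config d Ω)) : Prop :=
  ∀ R ∈ Matrix.specialOrthogonalGroup (Fin d) ℤ, ν.map (fun S x => S (Matrix.mulVec R x)) = ν

/-- The expectation of the spin at the origin. -/
def magnetization {d : ℕ} {Ω : Set E} [MeasurableSpace E] (ν : Measure (Config d Ω)) : E :=
  ∫ S, (S 0 : E) ∂ν

/-- The weighted spin average `m₀ = ∑ₓ J_{0,x} Sₓ`. -/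
def weightedAverage {d : ℕ} {Ω : Set E} (J : Site d → Site d → ℝ) (S : Config d Ω) : E :=
  ∑' x, J 0 x • (S x : E)

/-- The cumulant generating function `G(b) = log ∫ exp (b, S) μ₀(dS)`. -/
def cumulantGF {Ω : Set E} [MeasurableSpace E] (μ₀ : Measure Ω) (b : E) : ℝ :=
  Real.log (∫ s, Real.exp (inner ℝ b (s : E)) ∂μ₀)

/-- The entropy function `inf_b (G(b) - (b, m))`, with values in `[-∞, 0]`. -/
def entropy {Ω : Set E} [MeasurableSpace E] (μ₀ : Measure Ω) (m : E) : EReal :=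
  ⨅ b : E, ((cumulantGF μ₀ b - inner ℝ b m : ℝ) : EReal)

/-- The mean-field free-energy function `-(β/2)|m|² - (h, m) - S(m)`, with values in
`(-∞, +∞]`. -/
def freeEnergy {Ω : Set E} [MeasurableSpace E] (μ₀ : Measure Ω) (β : ℝ) (h m : E) : EReal :=
  ((-(β / 2) * ‖m‖ ^ 2 - inner ℝ h m : ℝ) : EReal) - entropy μ₀ m

end Spins

end SpinModel

end

set_option linter.unusedSectionVars false

/-! The Gibbs variational inequality, ∫ (W - V) d(P tilted by V) ≤ log ∫ e^W dP - log ∫ e^V dP, is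
used twice with exchanged roles, P being the product of `μ₀` over a finite `Λ`. With V = Σ (b, S_x)
and W = -βℋ, the tilted measure is a product with mean m = ∇G(b). This gives log Z ≥ |Λ| (β/2 |m|² +
(h, m) + G(b) - (b, m)) up to a boundary error, for every boundary condition (`log_partition_ge`).
With V = -βℋ and W = Σ (c, S_x), the tilted measure is the finite-volume Gibbs measure. DLR
transfers the bound to `ν`, where translation invariance computes the energy per site in terms of m⋆
and U = ⟨(S₀, m₀)⟩ (`finite_volume_comparison`). Boundary terms are o(|Λ|) on large boxes, so
dividing by |Λ| leaves (c, m⋆) - (h, m⋆) - β/2 U ≤ G(c) - (β/2 |m|² + (h, m) + G(b) - (b, m)). An m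
with finite entropy need not be a gradient of G, but it is a limit of gradients without loss of
entropy (`exists_tiltedMean_near`). The infimum over c then bounds S(m⋆) from below, which is the
theorem rearranged. -/

namespace SpinModel

open MeasureTheory Filter Topology ProbabilityTheory

/-! ### Gibbs variational inequality and tilted product measures. -/

section Variational

variable {α : Type*} [MeasurableSpace α]

/-- A bounded measurable function has an integrable exponential. -/
theorem integrable_exp_of_bound (P : Measure α) [IsFiniteMeasure P] {V : α → ℝ}
    (hV : Measurable V) {C : ℝ} (hC : ∀ a, |V a| ≤ C) :
    Integrable (fun a => Real.exp (V a)) P := by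
  refine Integrable.of_bound (hV.exp).aestronglyMeasurable (Real.exp C) (ae_of_all _ fun a => ?_)
  rw [Real.norm_eq_abs, Real.abs_exp]
  exact Real.exp_le_exp.2 ((abs_le.1 (hC a)).2)

theorem integrable_of_bound (P : Measure α) [IsFiniteMeasure P] {V : α → ℝ}
    (hV : Measurable V) {C : ℝ} (hC : ∀ a, |V a| ≤ C) : Integrable V P :=
  Integrable.of_bound hV.aestronglyMeasurable C (ae_of_all _ hC)

/-- Jensen's inequality for the logarithm of an exponential moment. -/
theorem integral_le_log_integral_exp (Q : Measure α) [IsProbabilityMeasure Q] {X : α → ℝ}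
    (hX : Integrable X Q) (hexp : Integrable (fun a => Real.exp (X a)) Q) :
    ∫ a, X a ∂Q ≤ Real.log (∫ a, Real.exp (X a) ∂Q) := by
  have hpos : 0 < ∫ a, Real.exp (X a) ∂Q := integral_exp_pos hexp
  rw [Real.le_log_iff_exp_le hpos]
  exact convexOn_exp.map_integral_le Real.continuous_exp.continuousOn isClosed_univ
    (ae_of_all _ fun _ => Set.mem_univ _) hX hexp

/-- The Gibbs variational inequality for bounded potentials. -/
theorem integral_sub_tilted_le (P : Measure α) [IsProbabilityMeasure P] {V W : α → ℝ}
    (hV : Measurable V) (hW : Measurable W) {C D : ℝ} (hC : ∀ a, |V a| ≤ C)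
    (hD : ∀ a, |W a| ≤ D) :
    ∫ a, (W a - V a) ∂(P.tilted V) ≤
      Real.log (∫ a, Real.exp (W a) ∂P) - Real.log (∫ a, Real.exp (V a) ∂P) := by
  have hVi := integrable_exp_of_bound P hV hC
  have hWi := integrable_exp_of_bound P hW hD
  have := isProbabilityMeasure_tilted hVi
  have hm : Measurable (fun a => W a - V a) := hW.sub hV
  have hb : ∀ a, |W a - V a| ≤ D + C := fun a => (abs_sub _ _).trans (add_le_add (hD a) (hC a))
  refine (integral_le_log_integral_exp _ (integrable_of_bound _ hm hb)
    (integrable_exp_of_bound _ hm hb)).trans_eq ?_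
  rw [integral_exp_tilted V, Real.log_div]
  · simp
  · simpa using (integral_exp_pos hWi).ne'
  · exact (integral_exp_pos hVi).ne'

/-- A product measure tilted by a sum of one-site potentials is the product of the tilted
measures. -/
theorem pi_tilted_sum {ι : Type*} [Fintype ι] (P : Measure α) [IsProbabilityMeasure P]
    {f : α → ℝ} (hf : Integrable (fun a => Real.exp (f a)) P) :
    (Measure.pi fun _ : ι => P).tilted (fun σ => ∑ i, f (σ i)) =
      Measure.pi fun _ : ι => P.tilted f := by
  classical
  have := isProbabilityMeasure_tilted hf
  symm
  refine Measure.pi_eq fun s hs => ?_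
  rw [tilted_apply_eq_ofReal_integral' _ (MeasurableSet.univ_pi hs)]
  simp_rw [fun i => tilted_apply_eq_ofReal_integral' (μ := P) f (hs i)]
  rw [← ENNReal.ofReal_prod_of_nonneg fun i _ => by positivity]
  congr 1
  simp_rw [← fun i => integral_indicator (μ := P)
    (f := fun x => Real.exp (f x) / ∫ x, Real.exp (f x) ∂P) (hs i)]
  rw [← integral_fintype_prod_eq_prod, ← integral_indicator (MeasurableSet.univ_pi hs)]
  simp_rw [Real.exp_sum]
  rw [integral_fintype_prod_eq_pow (fun a => Real.exp (f a))]
  congr 1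
  funext σ
  by_cases h : ∀ i, σ i ∈ s i
  · rw [Set.indicator_of_mem (by simpa using h), Finset.prod_congr rfl
      fun i _ => Set.indicator_of_mem (h i) _, Finset.prod_div_distrib]
    simp
  · rw [Set.indicator_of_notMem (by simpa using h)]
    obtain ⟨i, hi⟩ := not_forall.1 h
    exact (Finset.prod_eq_zero (Finset.mem_univ i) (Set.indicator_of_notMem hi _)).symm

end Variational

/-! ### The one-site problem: cumulant generating function, its gradient and the entropy. -/

section Site

variable {E : Type*} [NormedAddCommGroup E] [InnerProductSpace ℝ E]
  [FiniteDimensional ℝ E] [MeasurableSpace E] [BorelSpace E] {Ω : Set E}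

theorem exists_norm_le_of_isCompact (hΩ : IsCompact Ω) :
    ∃ R, 0 ≤ R ∧ ∀ s : Ω, ‖(s : E)‖ ≤ R := by
  obtain ⟨R, hR⟩ := hΩ.isBounded.exists_norm_le
  exact ⟨max R 0, le_max_right _ _, fun s => (hR s s.2).trans (le_max_left _ _)⟩

theorem abs_inner_spin_le {R : ℝ} (hR : ∀ s : Ω, ‖(s : E)‖ ≤ R) (b : E) (s : Ω) :
    |inner ℝ b (s : E)| ≤ ‖b‖ * R :=
  (abs_real_inner_le_norm _ _).trans (mul_le_mul_of_nonneg_left (hR s) (norm_nonneg _))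

theorem measurable_inner_spin (b : E) : Measurable fun s : Ω => inner ℝ b (s : E) :=
  (continuous_const.inner continuous_subtype_val).measurable

/-- The one-site measure tilted by the linear potential `(b, ·)`. -/
noncomputable abbrev tiltedSpin (μ₀ : Measure Ω) (b : E) : Measure Ω :=
  μ₀.tilted fun s => inner ℝ b (s : E)

/-- The mean spin in the one-site measure with field `b`. -/
noncomputable abbrev tiltedMean (μ₀ : Measure Ω) (b : E) : E := ∫ s, (s : E) ∂tiltedSpin μ₀ b

theorem integrable_exp_inner (hΩ : IsCompact Ω) (μ₀ : Measure Ω) [IsFiniteMeasure μ₀] (b : E) :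
    Integrable (fun s : Ω => Real.exp (inner ℝ b (s : E))) μ₀ := by
  obtain ⟨R, -, hR⟩ := exists_norm_le_of_isCompact hΩ
  exact integrable_exp_of_bound _ (measurable_inner_spin b) (abs_inner_spin_le hR b)

theorem isProbabilityMeasure_tiltedSpin (hΩ : IsCompact Ω) (μ₀ : Measure Ω)
    [IsProbabilityMeasure μ₀] (b : E) : IsProbabilityMeasure (tiltedSpin μ₀ b) :=
  isProbabilityMeasure_tilted (integrable_exp_inner hΩ μ₀ b)

theorem integrable_spin (hΩ : IsCompact Ω) (P : Measure Ω) [IsFiniteMeasure P] :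
    Integrable (fun s : Ω => (s : E)) P := by
  obtain ⟨R, -, hR⟩ := exists_norm_le_of_isCompact hΩ
  exact Integrable.of_bound continuous_subtype_val.aestronglyMeasurable R (ae_of_all _ hR)

/-- Tilting composes, so behaviour of G near any b reduces to behaviour near 0 for the tilted
measure. -/
theorem cumulantGF_add (hΩ : IsCompact Ω) (μ₀ : Measure Ω) [IsProbabilityMeasure μ₀] (b v : E) :
    cumulantGF μ₀ (b + v) = cumulantGF μ₀ b + cumulantGF (tiltedSpin μ₀ b) v := by
  have h1 := integral_exp_pos (integrable_exp_inner hΩ μ₀ b)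
  have h2 := integral_exp_pos (integrable_exp_inner hΩ μ₀ (b + v))
  have h3 := integral_exp_tilted (μ := μ₀) (fun s : Ω => inner ℝ b (s : E))
    (fun s : Ω => inner ℝ v (s : E))
  unfold cumulantGF
  rw [h3, Real.log_div _ h1.ne']
  · simp [inner_add_left]
  · simpa [inner_add_left] using h2.ne'

theorem hasDerivAt_cumulantGF_line (hΩ : IsCompact Ω) (μ₀ : Measure Ω) [IsProbabilityMeasure μ₀]
    (b v : E) :
    HasDerivAt (fun t : ℝ => cumulantGF μ₀ (b + t • v)) (inner ℝ v (tiltedMean μ₀ b)) 0 := by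
  have := isProbabilityMeasure_tiltedSpin hΩ μ₀ b
  -- Spins are bounded, so all exponential moments exist and 0 is interior, as analyticity of `cgf`
  -- requires.
  have hset : integrableExpSet (fun s : Ω => inner ℝ v (s : E)) (tiltedSpin μ₀ b) = Set.univ := by
    refine Set.eq_univ_of_forall fun t => ?_
    have := integrable_exp_inner hΩ (tiltedSpin μ₀ b) (t • v)
    simpa [integrableExpSet, inner_smul_left] using this
  have hmem : (0 : ℝ) ∈ interior
      (integrableExpSet (fun s : Ω => inner ℝ v (s : E)) (tiltedSpin μ₀ b)) := by simp [hset]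
  have hd := (analyticAt_cgf hmem).differentiableAt.hasDerivAt
  rw [deriv_cgf_zero hmem] at hd
  have hi : ∫ s : Ω, inner ℝ v (s : E) ∂tiltedSpin μ₀ b = inner ℝ v (tiltedMean μ₀ b) :=
    integral_inner (integrable_spin hΩ _) v
  simp only [probReal_univ, div_one, hi] at hd
  have heq : (fun t : ℝ => cumulantGF μ₀ (b + t • v)) =
      fun t => cumulantGF μ₀ b + cgf (fun s : Ω => inner ℝ v (s : E)) (tiltedSpin μ₀ b) t := by
    funext t
    rw [cumulantGF_add hΩ]
    simp [cumulantGF, cgf, mgf, inner_smul_left]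
  rw [heq]
  exact hd.const_add _

/-- G is Lipschitz with constant R, the bound on the spins, because a tilted exponential moment of
(v, S) is at most e^(R‖v‖). -/
theorem continuous_cumulantGF (hΩ : IsCompact Ω) (μ₀ : Measure Ω) [IsProbabilityMeasure μ₀] :
    Continuous (cumulantGF μ₀) := by
  obtain ⟨R, hR0, hR⟩ := exists_norm_le_of_isCompact hΩ
  have hle : ∀ b v : E, cumulantGF μ₀ (b + v) ≤ cumulantGF μ₀ b + R * ‖v‖ := fun b v => by
    have := isProbabilityMeasure_tiltedSpin hΩ μ₀ b
    have hint := integrable_exp_inner hΩ (tiltedSpin μ₀ b) v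
    rw [cumulantGF_add hΩ]
    gcongr
    rw [cumulantGF, Real.log_le_iff_le_exp (integral_exp_pos hint)]
    calc _ ≤ ∫ _ : Ω, Real.exp (R * ‖v‖) ∂tiltedSpin μ₀ b :=
          integral_mono hint (integrable_const _) fun s => Real.exp_le_exp.2 (by
            have := (abs_le.1 (abs_inner_spin_le hR v s)).2
            linarith)
      _ = _ := by simp
  refine (LipschitzWith.of_le_add_mul R.toNNReal fun x y => ?_).continuous
  rw [Real.coe_toNNReal _ hR0, dist_eq_norm]
  simpa using hle y (x - y)

/-- Any real lower bound of `b ↦ G(b) - (b, m)` is, up to an arbitrarily small change of `m`,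
a lower bound of `G(b) - (b, ∇G(b))` for some field `b`. -/
theorem exists_tiltedMean_near (hΩ : IsCompact Ω) (μ₀ : Measure Ω) [IsProbabilityMeasure μ₀]
    {m : E} {c : ℝ} (hc : ∀ b, c ≤ cumulantGF μ₀ b - inner ℝ b m) {δ : ℝ} (hδ : 0 < δ) :
    ∃ b, ‖tiltedMean μ₀ b - m‖ < δ ∧ c ≤ cumulantGF μ₀ b - inner ℝ b (tiltedMean μ₀ b) := by
  have hc0 : c ≤ 0 := by simpa [cumulantGF] using hc 0
  -- The minimiser b found below satisfies (ε‖b‖)² ≤ 2ε(-c), and ε‖b‖ is the displacement of the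
  -- mean. The +1 in the witness covers c = 0.
  obtain ⟨ε, hε, hεδ⟩ : ∃ ε > 0, 2 * ε * (-c) < δ ^ 2 := by
    refine ⟨δ ^ 2 / (2 * (-c + 1)), by have : 0 < -c + 1 := by linarith
                                       positivity, ?_⟩
    have : 0 < -c + 1 := by linarith
    have h2 : 0 < δ ^ 2 := by positivity
    rw [show 2 * (δ ^ 2 / (2 * (-c + 1))) * -c = δ ^ 2 * (-c) / (-c + 1) by field_simp,
      div_lt_iff₀ this]
    nlinarith
  -- The infimum defining the entropy may not be attained; the quadratic penalty makes the function
  -- coercive and forces a minimiser.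
  set f : E → ℝ := fun b => cumulantGF μ₀ b - inner ℝ b m + ε / 2 * ‖b‖ ^ 2 with hf
  have hcont : Continuous f := ((continuous_cumulantGF hΩ μ₀).sub
    (continuous_id.inner continuous_const)).add (by fun_prop)
  have hlim : Tendsto f (cocompact E) atTop := by
    refine tendsto_atTop_mono (f := fun b => c + ε / 2 * ‖b‖ ^ 2)
      (fun b => by simp only [hf]; gcongr; exact hc b) ?_
    refine tendsto_atTop_add_const_left _ _ (Tendsto.const_mul_atTop (by positivity) ?_)
    exact (tendsto_pow_atTop two_ne_zero).comp (tendsto_norm_cocompact_atTop)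
  obtain ⟨b, hb⟩ := hcont.exists_forall_le hlim
  have hgrad : tiltedMean μ₀ b - m + ε • b = 0 := by
    refine ext_inner_left ℝ fun v => ?_
    have hd1 := hasDerivAt_cumulantGF_line hΩ μ₀ b v
    have hd2 : HasDerivAt (fun t : ℝ => -inner ℝ (b + t • v) m + ε / 2 * ‖b + t • v‖ ^ 2)
        (-inner ℝ v m + ε * inner ℝ v b) 0 := by
      have h1 : HasDerivAt (fun t : ℝ => -(inner ℝ b m + t * inner ℝ v m) + ε / 2 *
          (‖b‖ ^ 2 + 2 * t * inner ℝ v b + t ^ 2 * ‖v‖ ^ 2))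
          (-inner ℝ v m + ε * inner ℝ v b) 0 := by
        have := (((hasDerivAt_id (0 : ℝ)).mul_const (inner ℝ v m)).const_add (inner ℝ b m)).neg.add
          ((((((hasDerivAt_id (0 : ℝ)).const_mul 2).mul_const (inner ℝ v b)).const_add
            (‖b‖ ^ 2)).add (((hasDerivAt_id (0 : ℝ)).pow 2).mul_const (‖v‖ ^ 2))).const_mul (ε / 2))
        refine this.congr_deriv ?_
        simp
        ring
      convert h1 using 1
      funext t
      rw [norm_add_sq_real, inner_add_left, inner_smul_left, inner_smul_right, norm_smul,
        real_inner_comm v b, mul_pow, Real.norm_eq_abs, sq_abs]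
      simp
      left; ring
    have hd := hd1.add hd2
    have hmin : IsLocalMin ((fun t : ℝ => cumulantGF μ₀ (b + t • v)) +
        fun t : ℝ => -inner ℝ (b + t • v) m + ε / 2 * ‖b + t • v‖ ^ 2) 0 := by
      refine Eventually.of_forall fun t => ?_
      have := hb (b + t • v)
      simp only [hf] at this
      simp only [Pi.add_apply, zero_smul, add_zero]
      linarith
    have := hmin.hasDerivAt_eq_zero hd
    rw [inner_add_right, inner_sub_right, inner_smul_right, inner_zero_right]
    linarith
  have hmean : tiltedMean μ₀ b = m - ε • b := by
    rw [← sub_eq_zero, ← hgrad]; abel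
  refine ⟨b, ?_, ?_⟩
  -- Comparing f(b) with f(0) = 0 gives ε/2 ‖b‖² ≤ -c.
  · rw [hmean]
    have h0 := hb 0
    have h1 := hc b
    simp only [hf, cumulantGF, inner_zero_left, Real.exp_zero, integral_const, norm_zero] at h0
    simp at h0
    have h2 : ‖m - ε • b - m‖ = ε * ‖b‖ := by
      rw [sub_sub_cancel_left, norm_neg, norm_smul, Real.norm_of_nonneg hε.le]
    rw [h2]
    refine lt_of_pow_lt_pow_left₀ 2 hδ.le ?_
    simp only [cumulantGF] at h1
    nlinarith [mul_nonneg hε.le (sq_nonneg ‖b‖)]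
  -- Replacing m by m - εb only adds ε‖b‖² ≥ 0, so no entropy is lost.
  · rw [hmean, inner_sub_right, inner_smul_right, real_inner_self_eq_norm_sq]
    nlinarith [hc b, mul_nonneg hε.le (sq_nonneg ‖b‖)]

end Site

/-! ### Large boxes and the vanishing of boundary couplings per site. -/

section Boundary

variable {d : ℕ}

/-- The centred box of side length `2n + 1`. -/
noncomputable def box (d n : ℕ) : Finset (Site d) :=
  Finset.Icc (fun _ => -(n : ℤ)) (fun _ => (n : ℤ))

theorem mem_box {n : ℕ} {x : Site d} : x ∈ box d n ↔ ∀ i, -(n : ℤ) ≤ x i ∧ x i ≤ n := by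
  simp [box, Pi.le_def, forall_and]

theorem card_box (d n : ℕ) : (box d n).card = (2 * n + 1) ^ d := by
  rw [box, Pi.card_Icc]
  simp only [Int.card_Icc, Finset.prod_const, Finset.card_univ, Fintype.card_fin]
  congr 1
  omega

theorem card_box_pos (d n : ℕ) : (0 : ℝ) < (box d n).card := by
  rw [card_box]; positivity

/-- A fixed translation moves only a vanishing fraction of a large box out of the box. -/
theorem tendsto_card_exit_box (z : Site d) :
    Tendsto (fun n => (((box d n).filter fun x => x + z ∉ box d n).card : ℝ) / (box d n).card)
      atTop (𝓝 0) := by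
  obtain ⟨k, hk⟩ : ∃ k : ℕ, ∀ i, |z i| ≤ k :=
    ⟨∑ i, (z i).natAbs, fun i => by
      rw [Int.abs_eq_natAbs]
      exact_mod_cast Finset.single_le_sum (f := fun i => (z i).natAbs)
        (fun _ _ => Nat.zero_le _) (Finset.mem_univ i)⟩
  -- This is 1 - |box (n - k)| / |box n|: a shift by at most k in each coordinate keeps the smaller
  -- box inside the larger one.
  have hlim : Tendsto (fun n : ℕ => 1 - (1 - 2 * (k : ℝ) / (2 * n + 1)) ^ d) atTop (𝓝 0) := by
    have h1 : Tendsto (fun n : ℕ => 2 * (k : ℝ) / (2 * n + 1)) atTop (𝓝 0) := by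
      refine Tendsto.const_div_atTop ?_ _
      exact tendsto_atTop_add_const_right _ _
        (Tendsto.const_mul_atTop two_pos tendsto_natCast_atTop_atTop)
    simpa using ((h1.const_sub 1).pow d).const_sub 1
  refine tendsto_of_tendsto_of_tendsto_of_le_of_le' tendsto_const_nhds hlim
    (Eventually.of_forall fun n => by positivity) ?_
  filter_upwards [eventually_ge_atTop k] with n hn
  have hsub : (box d n).filter (fun x => x + z ∉ box d n) ⊆ box d n \ box d (n - k) := by
    intro x hx
    rw [Finset.mem_filter] at hx
    rw [Finset.mem_sdiff]
    refine ⟨hx.1, fun hx' => hx.2 (mem_box.2 fun i => ?_)⟩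
    have h1 := mem_box.1 hx' i
    have h2 := abs_le.1 (hk i)
    rw [Pi.add_apply]
    omega
  have hss : box d (n - k) ⊆ box d n := fun x hx => mem_box.2 fun i => by
    have := mem_box.1 hx i
    omega
  have hcard := Finset.card_le_card hsub
  rw [Finset.card_sdiff_of_subset hss] at hcard
  have hcard' : (((box d n).filter fun x => x + z ∉ box d n).card : ℝ) ≤
      (box d n).card - (box d (n - k)).card := by
    rw [← Nat.cast_sub (Finset.card_le_card hss)]
    exact_mod_cast hcard
  rw [div_le_iff₀ (card_box_pos d n)]
  refine hcard'.trans_eq ?_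
  rw [card_box, card_box, sub_mul, one_mul]
  push_cast [hn]
  rw [← mul_pow]
  congr 2
  field_simp
  ring

/-- The total strength of the couplings across the boundary of `Λ`. -/
noncomputable def boundaryStrength (J : Site d → Site d → ℝ) (Λ : Finset (Site d)) : ℝ :=
  ∑ x ∈ Λ, ∑' y : {y : Site d // y ∉ Λ}, |J x y|

variable {J : Site d → Site d → ℝ}

theorem summable_abs_row (hJ : IsNormalizedCoupling J) (hT : CouplingTranslationInvariant J)
    (x : Site d) : Summable fun y => |J x y| := by
  have h := ((Equiv.subRight x).summable_iff (f := fun y => |J 0 y|)).2 hJ.summable_abs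
  refine h.congr fun y => ?_
  rw [hT x y]
  rfl

theorem tsum_row (hJ : IsNormalizedCoupling J) (x : Site d) : ∑' y, J x y = 1 := by
  simp_rw [hJ.symm x]
  exact (hJ.hasSum_one x).tsum_eq

theorem boundaryStrength_nonneg (J : Site d → Site d → ℝ) (Λ : Finset (Site d)) :
    0 ≤ boundaryStrength J Λ :=
  Finset.sum_nonneg fun _ _ => tsum_nonneg fun _ => abs_nonneg _

/-- Grouping boundary pairs by displacement z isolates the summable weight |J₀z|, ready for
dominated convergence. -/
theorem boundaryStrength_eq_tsum (hJ : IsNormalizedCoupling J)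
    (hT : CouplingTranslationInvariant J) (Λ : Finset (Site d)) :
    boundaryStrength J Λ = ∑' z, |J 0 z| * ((Λ.filter fun x => x + z ∉ Λ).card : ℝ) := by
  classical
  have hrow : ∀ x, ∑' y : {y : Site d // y ∉ Λ}, |J x y| =
      ∑' z, |J 0 z| * (if x + z ∉ Λ then 1 else 0) := fun x => by
    refine (tsum_subtype {y | y ∉ Λ} (fun y => |J x y|)).trans ?_
    rw [← (Equiv.addLeft x).tsum_eq]
    refine tsum_congr fun z => ?_
    simp only [Equiv.coe_addLeft, Set.indicator_apply, Set.mem_ofPred_eq]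
    rw [hT x (x + z), add_sub_cancel_left]
    split_ifs <;> simp
  rw [boundaryStrength, Finset.sum_congr rfl fun x _ => hrow x, ← Summable.tsum_finsetSum]
  · refine tsum_congr fun z => ?_
    rw [← Finset.mul_sum, Finset.sum_boole]
  · intro x _
    refine Summable.of_nonneg_of_le (fun z => by positivity) (fun z => ?_) hJ.summable_abs
    split_ifs <;> simp

theorem tendsto_boundaryStrength_box (hJ : IsNormalizedCoupling J)
    (hT : CouplingTranslationInvariant J) :
    Tendsto (fun n => boundaryStrength J (box d n) / (box d n).card) atTop (𝓝 0) := by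
  have h : Tendsto (fun n => ∑' z, |J 0 z| *
      ((((box d n).filter fun x => x + z ∉ box d n).card : ℝ) / (box d n).card)) atTop
      (𝓝 (∑' z : Site d, |J 0 z| * 0)) := by
    refine tendsto_tsum_of_dominated_convergence hJ.summable_abs
      (fun z => (tendsto_card_exit_box z).const_mul _) (Eventually.of_forall fun n z => ?_)
    rw [Real.norm_of_nonneg (by positivity)]
    refine mul_le_of_le_one_right (abs_nonneg _) (div_le_one_of_le₀ ?_ (by positivity))
    exact_mod_cast Finset.card_filter_le _ _
  simp only [mul_zero, tsum_zero] at h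
  refine h.congr fun n => ?_
  rw [boundaryStrength_eq_tsum hJ hT, ← tsum_div_const]
  exact tsum_congr fun z => (mul_div_assoc _ _ _).symm

end Boundary

/-! ### Energy identities, boundary errors and continuity. -/

section Energy

variable {E : Type*} [NormedAddCommGroup E] [InnerProductSpace ℝ E]
  [FiniteDimensional ℝ E] {Ω : Set E} {d : ℕ} {J : Site d → Site d → ℝ}

/-- The field `∑_y J_{x,y} S_y` produced at `x` by the other spins. -/
noncomputable def localField (J : Site d → Site d → ℝ) (S : Config d Ω) (x : Site d) : E :=
  ∑' y, J x y • (S y : E)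

/-- The interaction energy inside `Λ`, each pair being counted twice. -/
noncomputable def innerPairSum (J : Site d → Site d → ℝ) (Λ : Finset (Site d)) (S : Config d Ω) :
    ℝ :=
  ∑ x ∈ Λ, ∑ y ∈ Λ.erase x, J x y * inner ℝ (S x : E) (S y : E)

/-- The interaction between `Λ` and its complement. -/
noncomputable def outerPairSum (J : Site d → Site d → ℝ) (Λ : Finset (Site d)) (S : Config d Ω) :
    ℝ :=
  ∑ x ∈ Λ, ∑' y : {y : Site d // y ∉ Λ}, J x y * inner ℝ (S x : E) (S y : E)

theorem neg_hamiltonian_eq (J : Site d → Site d → ℝ) (β : ℝ) (h : E) (Λ : Finset (Site d))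
    (S : Config d Ω) :
    -hamiltonian J β h Λ S = β * (1 / 2 * innerPairSum J Λ S + outerPairSum J Λ S) +
      ∑ x ∈ Λ, inner ℝ h (S x : E) := by
  unfold hamiltonian innerPairSum outerPairSum
  ring

variable {R : ℝ}

theorem abs_pair_le (hR0 : 0 ≤ R) (hR : ∀ s : Ω, ‖(s : E)‖ ≤ R) (S : Config d Ω) (x y : Site d) :
    |J x y * inner ℝ (S x : E) (S y : E)| ≤ |J x y| * R ^ 2 := by
  rw [abs_mul, sq]
  refine mul_le_mul_of_nonneg_left ((abs_real_inner_le_norm _ _).trans ?_) (abs_nonneg _)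
  exact mul_le_mul (hR _) (hR _) (norm_nonneg _) hR0

theorem norm_smul_spin_le (hR : ∀ s : Ω, ‖(s : E)‖ ≤ R) (S : Config d Ω) (x y : Site d) :
    ‖J x y • (S y : E)‖ ≤ |J x y| * R := by
  rw [norm_smul, Real.norm_eq_abs]
  exact mul_le_mul_of_nonneg_left (hR _) (abs_nonneg _)

theorem summable_pair (hJ : IsNormalizedCoupling J) (hT : CouplingTranslationInvariant J)
    (hR0 : 0 ≤ R) (hR : ∀ s : Ω, ‖(s : E)‖ ≤ R) (S : Config d Ω) (x : Site d) :
    Summable fun y => J x y * inner ℝ (S x : E) (S y : E) :=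
  Summable.of_norm_bounded ((summable_abs_row hJ hT x).mul_right (R ^ 2))
    (abs_pair_le hR0 hR S x)

theorem summable_smul_spin (hJ : IsNormalizedCoupling J) (hT : CouplingTranslationInvariant J)
    (hR : ∀ s : Ω, ‖(s : E)‖ ≤ R) (S : Config d Ω) (x : Site d) :
    Summable fun y => J x y • (S y : E) :=
  Summable.of_norm_bounded ((summable_abs_row hJ hT x).mul_right R) (norm_smul_spin_le hR S x)

theorem inner_localField (hJ : IsNormalizedCoupling J) (hT : CouplingTranslationInvariant J)
    (hR : ∀ s : Ω, ‖(s : E)‖ ≤ R) (S : Config d Ω) (x : Site d) :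
    inner ℝ (S x : E) (localField J S x) = ∑' y, J x y * inner ℝ (S x : E) (S y : E) := by
  have := (innerSL ℝ (S x : E)).map_tsum (summable_smul_spin hJ hT hR S x)
  simpa [localField, inner_smul_right] using this

theorem sum_erase_add_tsum_compl (hJ : IsNormalizedCoupling J) {Λ : Finset (Site d)} {x : Site d}
    (hx : x ∈ Λ) {f : Site d → ℝ} (hf : Summable fun y => J x y * f y) :
    ∑ y ∈ Λ.erase x, J x y * f y + ∑' y : {y : Site d // y ∉ Λ}, J x y * f y =
      ∑' y, J x y * f y := by
  rw [← hf.sum_add_tsum_subtype_compl Λ, ← Finset.add_sum_erase _ _ hx, hJ.diag x]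
  simp

theorem innerPairSum_add_outerPairSum (hJ : IsNormalizedCoupling J)
    (hT : CouplingTranslationInvariant J) (hR0 : 0 ≤ R) (hR : ∀ s : Ω, ‖(s : E)‖ ≤ R)
    (Λ : Finset (Site d)) (S : Config d Ω) :
    innerPairSum J Λ S + outerPairSum J Λ S =
      ∑ x ∈ Λ, inner ℝ (S x : E) (localField J S x) := by
  unfold innerPairSum outerPairSum
  rw [← Finset.sum_add_distrib]
  refine Finset.sum_congr rfl fun x hx => ?_
  rw [inner_localField hJ hT hR,
    sum_erase_add_tsum_compl hJ hx (summable_pair hJ hT hR0 hR S x)]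

theorem abs_outerPairSum_le (hJ : IsNormalizedCoupling J) (hT : CouplingTranslationInvariant J)
    (hR0 : 0 ≤ R) (hR : ∀ s : Ω, ‖(s : E)‖ ≤ R) (Λ : Finset (Site d)) (S : Config d Ω) :
    |outerPairSum J Λ S| ≤ boundaryStrength J Λ * R ^ 2 := by
  unfold outerPairSum
  rw [boundaryStrength, Finset.sum_mul]
  refine (Finset.abs_sum_le_sum_abs _ _).trans (Finset.sum_le_sum fun x _ => ?_)
  rw [← tsum_mul_right, ← Real.norm_eq_abs]
  exact tsum_of_norm_bounded (((summable_abs_row hJ hT x).subtype _).mul_right (R ^ 2)).hasSum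
    fun y : {y : Site d // y ∉ Λ} => abs_pair_le (J := J) hR0 hR S x y

/-- Inner pairs carry weight 1/2 and outer pairs weight 1. Giving both weight 1/2 produces the
local-field sum; the remaining half of the outer pairs is the boundary error. -/
theorem neg_hamiltonian_le (hJ : IsNormalizedCoupling J) (hT : CouplingTranslationInvariant J)
    (hR0 : 0 ≤ R) (hR : ∀ s : Ω, ‖(s : E)‖ ≤ R) {β : ℝ} (hβ : 0 ≤ β) (h : E)
    (Λ : Finset (Site d)) (S : Config d Ω) :
    -hamiltonian J β h Λ S ≤ ∑ x ∈ Λ, (β / 2 * inner ℝ (S x : E) (localField J S x) +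
      inner ℝ h (S x : E)) + β / 2 * (boundaryStrength J Λ * R ^ 2) := by
  rw [neg_hamiltonian_eq, Finset.sum_add_distrib, ← Finset.mul_sum,
    ← innerPairSum_add_outerPairSum hJ hT hR0 hR]
  have := mul_le_mul_of_nonneg_left (abs_le.1 (abs_outerPairSum_le hJ hT hR0 hR Λ S)).2 hβ
  linarith

theorem continuous_pair (x y : Site d) :
    Continuous fun S : Config d Ω => J x y * inner ℝ (S x : E) (S y : E) := by
  fun_prop

theorem continuous_hamiltonian (hJ : IsNormalizedCoupling J) (hT : CouplingTranslationInvariant J)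
    (hR0 : 0 ≤ R) (hR : ∀ s : Ω, ‖(s : E)‖ ≤ R) (β : ℝ) (h : E) (Λ : Finset (Site d)) :
    Continuous fun S : Config d Ω => hamiltonian J β h Λ S := by
  have houter : ∀ x, Continuous fun S : Config d Ω =>
      ∑' y : {y : Site d // y ∉ Λ}, J x y * inner ℝ (S x : E) (S y : E) := fun x =>
    continuous_tsum (fun y => continuous_pair x y)
      (((summable_abs_row hJ hT x).subtype _).mul_right (R ^ 2))
      fun y S => abs_pair_le hR0 hR S x y
  unfold hamiltonian
  fun_prop

theorem continuous_localField (hJ : IsNormalizedCoupling J) (hT : CouplingTranslationInvariant J)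
    (hR : ∀ s : Ω, ‖(s : E)‖ ≤ R) (x : Site d) :
    Continuous fun S : Config d Ω => localField J S x :=
  continuous_tsum (fun y => by fun_prop)
    ((summable_abs_row hJ hT x).mul_right R) fun y S => norm_smul_spin_le hR S x y

theorem continuous_glue (Λ : Finset (Site d)) :
    Continuous fun p : (Λ → Ω) × Config d Ω => glue Λ p.1 p.2 := by
  refine continuous_pi fun x => ?_
  by_cases hx : x ∈ Λ
  · simp only [glue, hx, dite_true]; fun_prop
  · simp only [glue, hx, dite_false]; fun_prop

theorem localField_shift (hT : CouplingTranslationInvariant J) (S : Config d Ω) (x : Site d) :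
    localField J S x = weightedAverage J fun y => S (y + x) := by
  unfold localField weightedAverage
  rw [← (Equiv.addRight x).tsum_eq]
  refine tsum_congr fun y => ?_
  rw [Equiv.coe_addRight, hT x (y + x), add_sub_cancel_right]

end Energy

/-! ### Expectations under product measures. -/

section Partition

variable {E : Type*} [NormedAddCommGroup E] [InnerProductSpace ℝ E]
  [FiniteDimensional ℝ E] [MeasurableSpace E] [BorelSpace E] {Ω : Set E} {d : ℕ}
  {J : Site d → Site d → ℝ}

theorem log_integral_exp_sum_field (μ₀ : Measure Ω) [IsProbabilityMeasure μ₀]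
    {ι : Type*} [Fintype ι] (b : E) :
    Real.log (∫ σ : ι → Ω, Real.exp (∑ i, inner ℝ b (σ i : E)) ∂Measure.pi fun _ => μ₀) =
      Fintype.card ι * cumulantGF μ₀ b := by
  simp_rw [Real.exp_sum]
  rw [integral_fintype_prod_eq_pow (fun s : Ω => Real.exp (inner ℝ b (s : E))), Real.log_pow,
    cumulantGF]

theorem integrable_spin_pi (hΩ : IsCompact Ω) {ι : Type*} [Fintype ι] (P : Measure Ω)
    [IsProbabilityMeasure P] (i : ι) :
    Integrable (fun σ : ι → Ω => (σ i : E)) (Measure.pi fun _ => P) :=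
  integrable_comp_eval (μ := fun _ : ι => P) (f := fun s : Ω => (s : E)) (integrable_spin hΩ P)

theorem integral_spin_pi (hΩ : IsCompact Ω) {ι : Type*} [Fintype ι] (P : Measure Ω)
    [IsProbabilityMeasure P] (i : ι) :
    ∫ σ : ι → Ω, (σ i : E) ∂(Measure.pi fun _ => P) = ∫ s, (s : E) ∂P :=
  integral_comp_eval (μ := fun _ : ι => P) (f := fun s : Ω => (s : E))
    (integrable_spin hΩ P).aestronglyMeasurable

theorem integral_inner_spin_pi (hΩ : IsCompact Ω) {ι : Type*} [Fintype ι] (P : Measure Ω)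
    [IsProbabilityMeasure P] (v : E) (i : ι) :
    ∫ σ : ι → Ω, inner ℝ v (σ i : E) ∂(Measure.pi fun _ => P) = inner ℝ v (∫ s, (s : E) ∂P) := by
  rw [integral_inner (integrable_spin_pi hΩ P i) v, integral_spin_pi hΩ]

theorem integral_inner_pair_pi (hΩ : IsCompact Ω) {ι : Type*} [Fintype ι] (P : Measure Ω)
    [IsProbabilityMeasure P] {i j : ι} (hij : i ≠ j) :
    ∫ σ : ι → Ω, inner ℝ (σ i : E) (σ j : E) ∂(Measure.pi fun _ => P) =
      ‖∫ s, (s : E) ∂P‖ ^ 2 := by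
  have hind := (iIndepFun_pi (μ := fun _ : ι => P) (X := fun _ (s : Ω) => (s : E))
    fun _ => continuous_subtype_val.aemeasurable).indepFun hij
  have := hind.integral_bilin (integrable_spin_pi hΩ P i) (integrable_spin_pi hΩ P j) (innerSL ℝ)
  rw [integral_spin_pi hΩ P i, integral_spin_pi hΩ P j] at this
  rw [← real_inner_self_eq_norm_sq]
  exact this

end Partition

/-! ### Mean-field bound on the partition function and use of the DLR equations. -/

section FiniteVolume

variable {E : Type*} [NormedAddCommGroup E] [InnerProductSpace ℝ E]
  [FiniteDimensional ℝ E] [MeasurableSpace E] [BorelSpace E] {Ω : Set E} {d : ℕ}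
  {J : Site d → Site d → ℝ}

theorem integrable_of_continuous {X : Type*} [TopologicalSpace X] [CompactSpace X]
    [MeasurableSpace X] [OpensMeasurableSpace X] (P : Measure X) [IsFiniteMeasure P] {f : X → ℝ}
    (hf : Continuous f) : Integrable f P := by
  obtain ⟨C, hC⟩ := (isCompact_univ (X := X)).exists_bound_of_continuousOn hf.continuousOn
  exact integrable_of_bound P hf.measurable fun x => hC x (Set.mem_univ _)

theorem glue_of_mem {Λ : Finset (Site d)} {x : Site d} (hx : x ∈ Λ) (σ : Λ → Ω)
    (η : Config d Ω) : glue Λ σ η x = σ ⟨x, hx⟩ := by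
  simp [glue, hx]

theorem sum_glue (Λ : Finset (Site d)) (σ : Λ → Ω) (η : Config d Ω) (φ : Ω → ℝ) :
    ∑ x ∈ Λ, φ (glue Λ σ η x) = ∑ i, φ (σ i) := by
  rw [← Finset.sum_coe_sort]
  exact Finset.sum_congr rfl fun i _ => by rw [glue_of_mem i.2]

theorem integral_innerPairSum (hΩ : IsCompact Ω) (P : Measure Ω) [IsProbabilityMeasure P]
    (Λ : Finset (Site d)) (η : Config d Ω) :
    ∫ σ : Λ → Ω, innerPairSum J Λ (glue Λ σ η) ∂(Measure.pi fun _ => P) =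
      ∑ x ∈ Λ, ∑ y ∈ Λ.erase x, J x y * ‖∫ s, (s : E) ∂P‖ ^ 2 := by
  have := isCompact_iff_compactSpace.1 hΩ
  have hcont : ∀ x y, Continuous fun σ : Λ → Ω =>
      J x y * inner ℝ (glue Λ σ η x : E) (glue Λ σ η y : E) := fun x y =>
    (continuous_pair x y).comp ((continuous_glue Λ).comp (by fun_prop : Continuous fun σ => (σ, η)))
  unfold innerPairSum
  rw [integral_finsetSum _ fun x _ => integrable_finsetSum _ fun y _ =>
    integrable_of_continuous _ (hcont x y)]
  refine Finset.sum_congr rfl fun x hx => ?_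
  rw [integral_finsetSum _ fun y _ => integrable_of_continuous _ (hcont x y)]
  refine Finset.sum_congr rfl fun y hy => ?_
  rw [Finset.mem_erase] at hy
  rw [integral_const_mul, ← integral_inner_pair_pi hΩ P
    (i := (⟨x, hx⟩ : Λ)) (j := ⟨y, hy.2⟩) (by simpa using hy.1.symm)]
  simp_rw [glue_of_mem hx, glue_of_mem hy.2]

/-- Each row of J sums to 1, so the part inside `Λ` falls short of 1 by at most the absolute
coupling to the outside. Applied with a = ‖m‖² and r = R². -/
theorem sum_coupling_mul_ge (hJ : IsNormalizedCoupling J) (hT : CouplingTranslationInvariant J)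
    (Λ : Finset (Site d)) {a r : ℝ} (ha : 0 ≤ a) (har : a ≤ r) :
    Λ.card * a - boundaryStrength J Λ * r ≤ ∑ x ∈ Λ, ∑ y ∈ Λ.erase x, J x y * a := by
  have hrow : ∀ x ∈ Λ, 1 - ∑' y : {y : Site d // y ∉ Λ}, |J x y| ≤ ∑ y ∈ Λ.erase x, J x y := by
    intro x hx
    have h1 := sum_erase_add_tsum_compl hJ hx (f := fun _ => 1)
      (by simpa using (summable_abs_row hJ hT x).of_abs)
    simp only [mul_one, tsum_row hJ x] at h1
    have h2 : ∑' y : {y : Site d // y ∉ Λ}, J x y ≤ ∑' y : {y : Site d // y ∉ Λ}, |J x y| :=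
      Summable.tsum_le_tsum (fun y => le_abs_self _)
        ((summable_abs_row hJ hT x).of_abs.subtype _) ((summable_abs_row hJ hT x).subtype _)
    linarith
  have h1 := Finset.sum_le_sum hrow
  rw [Finset.sum_sub_distrib] at h1
  simp only [Finset.sum_const, nsmul_eq_mul, mul_one] at h1
  change _ - boundaryStrength J Λ ≤ _ at h1
  simp_rw [← Finset.sum_mul]
  have h2 := mul_le_mul_of_nonneg_right h1 ha
  have h3 := mul_le_mul_of_nonneg_left har (boundaryStrength_nonneg J Λ)
  linarith

/-- Mean-field lower bound on the finite-volume partition function, uniform in the boundary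
condition. -/
theorem log_partition_ge (hΩ : IsCompact Ω) (μ₀ : Measure Ω) [IsProbabilityMeasure μ₀]
    (hJ : IsNormalizedCoupling J) (hT : CouplingTranslationInvariant J) {R : ℝ}
    (hR0 : 0 ≤ R) (hR : ∀ s : Ω, ‖(s : E)‖ ≤ R) {β : ℝ} (hβ : 0 ≤ β) (h b : E)
    (Λ : Finset (Site d)) (η : Config d Ω) :
    Λ.card * (β / 2 * ‖tiltedMean μ₀ b‖ ^ 2 + inner ℝ h (tiltedMean μ₀ b) +
        (cumulantGF μ₀ b - inner ℝ b (tiltedMean μ₀ b))) -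
        3 / 2 * β * (boundaryStrength J Λ * R ^ 2) ≤
      Real.log (∫ σ : Λ → Ω, Real.exp (-hamiltonian J β h Λ (glue Λ σ η))
        ∂Measure.pi fun _ => μ₀) := by
  have := isCompact_iff_compactSpace.1 hΩ
  have := isProbabilityMeasure_tiltedSpin hΩ μ₀ b
  set m := tiltedMean μ₀ b with hm
  have hglue : Continuous fun σ : Λ → Ω => glue Λ σ η :=
    (continuous_glue Λ).comp (by fun_prop : Continuous fun σ : Λ → Ω => (σ, η))
  have hcH : Continuous fun σ : Λ → Ω => -hamiltonian J β h Λ (glue Λ σ η) :=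
    ((continuous_hamiltonian hJ hT hR0 hR β h Λ).comp hglue).neg
  have hcW : ∀ v : E, Continuous fun σ : Λ → Ω => ∑ i, inner ℝ v (σ i : E) := fun v => by
    fun_prop
  have hcI : Continuous fun σ : Λ → Ω => innerPairSum J Λ (glue Λ σ η) := by
    unfold innerPairSum
    exact continuous_finsetSum _ fun x _ => continuous_finsetSum _ fun y _ =>
      (continuous_pair x y).comp hglue
  obtain ⟨C, hC⟩ := (isCompact_univ (X := Λ → Ω)).exists_bound_of_continuousOn hcH.continuousOn
  obtain ⟨D, hD⟩ := (isCompact_univ (X := Λ → Ω)).exists_bound_of_continuousOn (hcW b).continuousOn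
  -- The trial measure is the tilt by Σ (b, S_x), a product of one-site tilts.
  have key := integral_sub_tilted_le (Measure.pi fun _ : Λ => μ₀) (hcW b).measurable
    hcH.measurable (fun σ => hD σ (Set.mem_univ _)) (fun σ => hC σ (Set.mem_univ _))
  rw [log_integral_exp_sum_field, pi_tilted_sum μ₀ (integrable_exp_inner hΩ μ₀ b),
    Fintype.card_coe] at key
  set Q : Measure (Λ → Ω) := Measure.pi fun _ : Λ => tiltedSpin μ₀ b with hQ
  have hfield : ∀ v : E, ∫ σ, ∑ i, inner ℝ v (σ i : E) ∂Q = Λ.card * inner ℝ v m := fun v => by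
    rw [integral_finsetSum _ fun i _ => integrable_of_continuous _ (by fun_prop),
      Finset.sum_congr rfl fun i _ => integral_inner_spin_pi hΩ (tiltedSpin μ₀ b) v i]
    simp [hm]
  have hmR : ‖m‖ ^ 2 ≤ R ^ 2 := by
    have : ‖m‖ ≤ R := by
      simpa using norm_integral_le_of_norm_le_const (μ := tiltedSpin μ₀ b) (ae_of_all _ hR)
    gcongr
  -- Discarding the outer pairs costs β times the boundary term and removes `η`; the missing
  -- couplings in `hsum` cost another β/2, whence 3/2.
  have hlow : ∀ σ : Λ → Ω, β / 2 * innerPairSum J Λ (glue Λ σ η) + ∑ i, inner ℝ h (σ i : E) -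
      β * (boundaryStrength J Λ * R ^ 2) - ∑ i, inner ℝ b (σ i : E) ≤
      -hamiltonian J β h Λ (glue Λ σ η) - ∑ i, inner ℝ b (σ i : E) := fun σ => by
    rw [neg_hamiltonian_eq, sum_glue Λ σ η fun s => inner ℝ h (s : E)]
    have := mul_le_mul_of_nonneg_left
      (abs_le.1 (abs_outerPairSum_le hJ hT hR0 hR Λ (glue Λ σ η))).1 hβ
    linarith
  have hmono := integral_mono (μ := Q) (integrable_of_continuous Q (by fun_prop))
    (integrable_of_continuous Q (hcH.sub (hcW b))) hlow
  rw [integral_sub (integrable_of_continuous Q (by fun_prop))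
      (integrable_of_continuous Q (by fun_prop)),
    integral_sub (integrable_of_continuous Q (by fun_prop)) (integrable_const _),
    integral_add (integrable_of_continuous Q (by fun_prop))
      (integrable_of_continuous Q (by fun_prop)), integral_const_mul, hfield, hfield,
    integral_innerPairSum hΩ] at hmono
  simp only [integral_const, probReal_univ, one_smul, Pi.sub_apply] at hmono
  change β / 2 * ∑ x ∈ Λ, ∑ y ∈ Λ.erase x, J x y * ‖m‖ ^ 2 + _ - _ - _ ≤ _ at hmono
  have hsum := mul_le_mul_of_nonneg_left
    (sum_coupling_mul_ge hJ hT Λ (sq_nonneg ‖m‖) hmR) (by positivity : 0 ≤ β / 2)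
  linarith

/-- The one-step resampling map `η ↦ (finite-volume Gibbs measure glued to η)` is measurable. -/
theorem measurable_resample (hΩ : IsCompact Ω) (μ₀ : Measure Ω) [IsProbabilityMeasure μ₀]
    (hJ : IsNormalizedCoupling J) (hT : CouplingTranslationInvariant J) (β : ℝ) (h : E)
    (Λ : Finset (Site d)) :
    Measurable fun η : Config d Ω =>
      (finiteVolumeGibbs μ₀ J β h Λ η).map fun σ => glue Λ σ η := by
  obtain ⟨R, hR0, hR⟩ := exists_norm_le_of_isCompact hΩ
  have hg := (continuous_glue (Ω := Ω) Λ).measurable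
  have hH : Measurable fun p : (Λ → Ω) × Config d Ω =>
      Real.exp (-hamiltonian J β h Λ (glue Λ p.1 p.2)) :=
    (((continuous_hamiltonian hJ hT hR0 hR β h Λ).comp (continuous_glue Λ)).measurable).neg.exp
  have hZ : Measurable fun η : Config d Ω =>
      ∫ σ, Real.exp (-hamiltonian J β h Λ (glue Λ σ η)) ∂(Measure.pi fun _ : Λ => μ₀) :=
    (hH.stronglyMeasurable.integral_prod_left' (μ := Measure.pi fun _ : Λ => μ₀)).measurable
  refine Measure.measurable_of_measurable_coe _ fun A hA => ?_
  have heq : ∀ η : Config d Ω, (finiteVolumeGibbs μ₀ J β h Λ η).map (fun σ => glue Λ σ η) A =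
      ∫⁻ σ, ((fun p : (Λ → Ω) × Config d Ω => glue Λ p.1 p.2) ⁻¹' A).indicator
        (fun p => ENNReal.ofReal (Real.exp (-hamiltonian J β h Λ (glue Λ p.1 p.2)) /
          ∫ τ, Real.exp (-hamiltonian J β h Λ (glue Λ τ p.2)) ∂(Measure.pi fun _ : Λ => μ₀)))
        (σ, η) ∂(Measure.pi fun _ : Λ => μ₀) := fun η => by
    have hgη : Measurable fun σ : Λ → Ω => glue Λ σ η := hg.comp measurable_prodMk_right
    rw [Measure.map_apply hgη hA, finiteVolumeGibbs, tilted_apply' _ _ (hgη hA),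
      ← lintegral_indicator (hgη hA)]
    rfl
  simp_rw [heq]
  refine Measurable.lintegral_prod_left' ?_
  exact ((hH.div (hZ.comp measurable_snd)).ennreal_ofReal).indicator (hg hA)

/-- A bound on the resampled expectation of an observable, uniform in the boundary condition,
passes to the Gibbs measure. -/
theorem IsGibbsMeasure.integral_le (hΩ : IsCompact Ω) {μ₀ : Measure Ω} [IsProbabilityMeasure μ₀]
    (hJ : IsNormalizedCoupling J) (hT : CouplingTranslationInvariant J) {β : ℝ} {h : E}
    {ν : Measure (Config d Ω)} (hν : IsGibbsMeasure μ₀ J β h ν) (Λ : Finset (Site d))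
    {g : Config d Ω → ℝ} (hg : Continuous g) {K : ℝ}
    (hK : ∀ η, ∫ σ, g (glue Λ σ η) ∂finiteVolumeGibbs μ₀ J β h Λ η ≤ K) :
    ∫ S, g S ∂ν ≤ K := by
  have := isCompact_iff_compactSpace.1 hΩ
  have := hν.isProbabilityMeasure
  have hgl : ∀ η : Config d Ω, Measurable fun σ : Λ → Ω => glue Λ σ η := fun η =>
    (continuous_glue Λ).measurable.comp measurable_prodMk_right
  let κ : Kernel (Config d Ω) (Config d Ω) := ⟨_, measurable_resample hΩ μ₀ hJ hT β h Λ⟩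
  -- DLR as invariance of `ν` under the resampling kernel, which extends it from events to
  -- integrals.
  have hbind : κ ∘ₘ ν = ν := by
    refine Measure.ext fun A hA => ?_
    rw [Measure.bind_apply hA κ.aemeasurable, hν.dlr Λ A hA]
    exact lintegral_congr fun η => Measure.map_apply (hgl η) hA
  have hint : Integrable g (κ ∘ₘ ν) := by
    rw [hbind]; exact integrable_of_continuous ν hg
  have h1 : ∫ S, g S ∂ν = ∫ η, ∫ S, g S ∂κ η ∂ν := by
    conv_lhs => rw [← hbind]
    rw [Measure.comp_eq_comp_const_apply] at hint ⊢
    rw [Kernel.integral_comp hint, Kernel.const_apply]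
  have h2 : ∀ η, ∫ S, g S ∂κ η ≤ K := fun η => by
    refine le_trans (le_of_eq ?_) (hK η)
    exact integral_map (hgl η).aemeasurable hg.aestronglyMeasurable
  rw [h1]
  by_cases hi : Integrable (fun η => ∫ S, g S ∂κ η) ν
  · simpa using integral_mono hi (integrable_const K) h2
  · rw [Measure.comp_eq_comp_const_apply] at hint
    exact (hi (by simpa using hint.integral_comp)).elim

end FiniteVolume

/-! ### Comparing the Gibbs state with mean-field trial states. -/

section Comparison

variable {E : Type*} [NormedAddCommGroup E] [InnerProductSpace ℝ E]
  [FiniteDimensional ℝ E] [MeasurableSpace E] [BorelSpace E] {Ω : Set E} {d : ℕ}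
  {J : Site d → Site d → ℝ}

theorem measurable_shift (a : Site d) :
    Measurable fun (S : Config d Ω) (x : Site d) => S (x + a) :=
  measurable_pi_lambda _ fun x => measurable_pi_apply (x + a)

theorem TranslationInvariant.integral_shift {F : Type*} [NormedAddCommGroup F] [NormedSpace ℝ F]
    {ν : Measure (Config d Ω)} (hν : TranslationInvariant ν) {f : Config d Ω → F}
    (hf : Continuous f) [SecondCountableTopology F] (a : Site d) :
    ∫ S, f (fun x => S (x + a)) ∂ν = ∫ S, f S ∂ν := by
  conv_rhs => rw [← hν a]
  exact (integral_map (measurable_shift a).aemeasurable hf.aestronglyMeasurable).symm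

theorem integral_inner_spin (hΩ : IsCompact Ω) {ν : Measure (Config d Ω)} [IsProbabilityMeasure ν]
    (hν : TranslationInvariant ν) (v : E) (x : Site d) :
    ∫ S, inner ℝ v (S x : E) ∂ν = inner ℝ v (magnetization ν) := by
  obtain ⟨R, -, hR⟩ := exists_norm_le_of_isCompact hΩ
  have hc : Continuous fun S : Config d Ω => (S 0 : E) := by fun_prop
  have hi : Integrable (fun S : Config d Ω => (S 0 : E)) ν :=
    Integrable.of_bound hc.aestronglyMeasurable R (ae_of_all _ fun S => hR _)
  rw [magnetization, ← integral_inner hi v,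
    ← hν.integral_shift (f := fun S : Config d Ω => inner ℝ v (S 0 : E)) (by fun_prop) x]
  simp

theorem integral_inner_localField (hJ : IsNormalizedCoupling J)
    (hT : CouplingTranslationInvariant J) (hΩ : IsCompact Ω) {ν : Measure (Config d Ω)}
    (hν : TranslationInvariant ν) (x : Site d) :
    ∫ S, inner ℝ (S x : E) (localField J S x) ∂ν =
      ∫ S, inner ℝ (S 0 : E) (weightedAverage J S) ∂ν := by
  obtain ⟨R, -, hR⟩ := exists_norm_le_of_isCompact hΩ
  have hc : Continuous fun S : Config d Ω => inner ℝ (S 0 : E) (weightedAverage J S) :=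
    Continuous.inner (by fun_prop) (continuous_localField hJ hT hR 0)
  rw [← hν.integral_shift hc x]
  simp_rw [localField_shift hT]
  simp

/-- Comparison in finite volume: Jensen's inequality in the Gibbs measure against the mean-field
lower bound on the partition function. -/
theorem finite_volume_comparison (hΩ : IsCompact Ω) (μ₀ : Measure Ω) [IsProbabilityMeasure μ₀]
    (hJ : IsNormalizedCoupling J) (hT : CouplingTranslationInvariant J) {R : ℝ}
    (hR0 : 0 ≤ R) (hR : ∀ s : Ω, ‖(s : E)‖ ≤ R) {β : ℝ} (hβ : 0 ≤ β) (h b c : E)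
    {ν : Measure (Config d Ω)} (hν : IsGibbsMeasure μ₀ J β h ν) (hνT : TranslationInvariant ν)
    (Λ : Finset (Site d)) :
    Λ.card * (inner ℝ c (magnetization ν) - inner ℝ h (magnetization ν) -
        β / 2 * ∫ S, inner ℝ (S 0 : E) (weightedAverage J S) ∂ν) ≤
      Λ.card * (cumulantGF μ₀ c - (β / 2 * ‖tiltedMean μ₀ b‖ ^ 2 + inner ℝ h (tiltedMean μ₀ b) +
        (cumulantGF μ₀ b - inner ℝ b (tiltedMean μ₀ b)))) +
        2 * β * (boundaryStrength J Λ * R ^ 2) := by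
  have := isCompact_iff_compactSpace.1 hΩ
  have := hν.isProbabilityMeasure
  set m := tiltedMean μ₀ b
  set U := ∫ S, inner ℝ (S 0 : E) (weightedAverage J S) ∂ν
  have hcH := continuous_hamiltonian hJ hT hR0 hR β h Λ
  have hfield : ∀ v x, Integrable (fun S : Config d Ω => inner ℝ v (S x : E)) ν := fun v x =>
    integrable_of_continuous ν (by fun_prop)
  have hloc : ∀ x, Continuous fun S : Config d Ω => inner ℝ (S x : E) (localField J S x) :=
    fun x => Continuous.inner (by fun_prop) (continuous_localField hJ hT hR x)
  have hupper : ∫ S, (∑ x ∈ Λ, inner ℝ c (S x : E) + hamiltonian J β h Λ S) ∂ν ≤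
      Λ.card * (cumulantGF μ₀ c - (β / 2 * ‖m‖ ^ 2 + inner ℝ h m +
        (cumulantGF μ₀ b - inner ℝ b m))) + 3 / 2 * β * (boundaryStrength J Λ * R ^ 2) := by
    refine hν.integral_le hΩ hJ hT Λ (by fun_prop) fun η => ?_
    have hglue : Continuous fun σ : Λ → Ω => glue Λ σ η :=
      (continuous_glue Λ).comp (by fun_prop : Continuous fun σ : Λ → Ω => (σ, η))
    have hcV : Continuous fun σ : Λ → Ω => -hamiltonian J β h Λ (glue Λ σ η) :=
      (hcH.comp hglue).neg
    have hcW : Continuous fun σ : Λ → Ω => ∑ i, inner ℝ c (σ i : E) := by fun_prop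
    obtain ⟨C, hC⟩ := (isCompact_univ (X := Λ → Ω)).exists_bound_of_continuousOn hcV.continuousOn
    obtain ⟨D, hD⟩ := (isCompact_univ (X := Λ → Ω)).exists_bound_of_continuousOn hcW.continuousOn
    -- Roles reversed: the tilted measure is now the finite-volume Gibbs measure itself.
    have key := integral_sub_tilted_le (Measure.pi fun _ : Λ => μ₀) hcV.measurable
      hcW.measurable (fun σ => hC σ (Set.mem_univ _)) (fun σ => hD σ (Set.mem_univ _))
    rw [log_integral_exp_sum_field, Fintype.card_coe] at key
    have hZ := log_partition_ge hΩ μ₀ hJ hT hR0 hR hβ h b Λ η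
    simp only [sub_neg_eq_add] at key
    simp_rw [fun σ => sum_glue Λ σ η fun s => inner ℝ c (s : E)]
    unfold finiteVolumeGibbs
    linarith
  -- Exact energy per site under `ν`, by translation invariance; its β/2 boundary error and the 3/2
  -- β of `hupper` add up to 2β.
  have hlower : Λ.card * inner ℝ c (magnetization ν) - (Λ.card * (β / 2 * U +
      inner ℝ h (magnetization ν)) + β / 2 * (boundaryStrength J Λ * R ^ 2)) ≤
      ∫ S, (∑ x ∈ Λ, inner ℝ c (S x : E) + hamiltonian J β h Λ S) ∂ν := by
    have hterm : ∀ x, Continuous fun S : Config d Ω =>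
        β / 2 * inner ℝ (S x : E) (localField J S x) + inner ℝ h (S x : E) := fun x =>
      ((hloc x).const_mul _).add (by fun_prop)
    have h1 : ∫ S, (∑ x ∈ Λ, (β / 2 * inner ℝ (S x : E) (localField J S x) +
        inner ℝ h (S x : E)) + β / 2 * (boundaryStrength J Λ * R ^ 2)) ∂ν =
        Λ.card * (β / 2 * U + inner ℝ h (magnetization ν)) +
          β / 2 * (boundaryStrength J Λ * R ^ 2) := by
      rw [integral_add (integrable_of_continuous ν (by fun_prop)) (integrable_const _),
        integral_finsetSum _ fun x _ => integrable_of_continuous ν (hterm x)]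
      have : ∀ x ∈ Λ, ∫ S, (β / 2 * inner ℝ (S x : E) (localField J S x) +
          inner ℝ h (S x : E)) ∂ν = β / 2 * U + inner ℝ h (magnetization ν) := fun x _ => by
        rw [integral_add ((integrable_of_continuous ν (hloc x)).const_mul _) (hfield h x),
          integral_const_mul, integral_inner_localField hJ hT hΩ hνT,
          integral_inner_spin hΩ hνT]
      rw [Finset.sum_congr rfl this, Finset.sum_const, nsmul_eq_mul]
      simp
    have h2 : ∫ S, ∑ x ∈ Λ, inner ℝ c (S x : E) ∂ν = Λ.card * inner ℝ c (magnetization ν) := by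
      rw [integral_finsetSum _ fun x _ => hfield c x,
        Finset.sum_congr rfl fun x _ => integral_inner_spin hΩ hνT c x]
      simp
    rw [← h1, ← h2, ← integral_sub (integrable_of_continuous ν (by fun_prop))
      (integrable_of_continuous ν (by fun_prop))]
    refine integral_mono (integrable_of_continuous ν (by fun_prop))
      (integrable_of_continuous ν (by fun_prop)) fun S => ?_
    have := neg_hamiltonian_le hJ hT hR0 hR hβ h Λ S
    simp only
    linarith
  linarith

/-- The infinite-volume limit of `finite_volume_comparison`. -/
theorem infinite_volume_comparison (hΩ : IsCompact Ω) (μ₀ : Measure Ω) [IsProbabilityMeasure μ₀]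
    (hJ : IsNormalizedCoupling J) (hT : CouplingTranslationInvariant J) {β : ℝ} (hβ : 0 ≤ β)
    (h b c : E) {ν : Measure (Config d Ω)} (hν : IsGibbsMeasure μ₀ J β h ν)
    (hνT : TranslationInvariant ν) :
    inner ℝ c (magnetization ν) - inner ℝ h (magnetization ν) -
        β / 2 * ∫ S, inner ℝ (S 0 : E) (weightedAverage J S) ∂ν ≤
      cumulantGF μ₀ c - (β / 2 * ‖tiltedMean μ₀ b‖ ^ 2 + inner ℝ h (tiltedMean μ₀ b) +
        (cumulantGF μ₀ b - inner ℝ b (tiltedMean μ₀ b))) := by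
  obtain ⟨R, hR0, hR⟩ := exists_norm_le_of_isCompact hΩ
  have hlim := (((tendsto_boundaryStrength_box hJ hT).const_mul (2 * β * R ^ 2)).const_add
    (cumulantGF μ₀ c - (β / 2 * ‖tiltedMean μ₀ b‖ ^ 2 + inner ℝ h (tiltedMean μ₀ b) +
        (cumulantGF μ₀ b - inner ℝ b (tiltedMean μ₀ b)))))
  rw [mul_zero, add_zero] at hlim
  refine ge_of_tendsto' hlim fun n => ?_
  have hfin := finite_volume_comparison hΩ μ₀ hJ hT hR0 hR hβ h b c hν hνT (box d n)
  have hpos := card_box_pos d n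
  refine le_of_mul_le_mul_left (hfin.trans_eq ?_) hpos
  field_simp

/-- The mean-field comparison for an arbitrary `m` at which the entropy has a finite lower
bound. -/
theorem entropy_magnetization_ge (hΩ : IsCompact Ω) (μ₀ : Measure Ω) [IsProbabilityMeasure μ₀]
    (hJ : IsNormalizedCoupling J) (hT : CouplingTranslationInvariant J) {β : ℝ} (hβ : 0 ≤ β)
    (h m c : E) {s : ℝ} (hs : ∀ b, s ≤ cumulantGF μ₀ b - inner ℝ b m)
    {ν : Measure (Config d Ω)} (hν : IsGibbsMeasure μ₀ J β h ν) (hνT : TranslationInvariant ν) :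
    β / 2 * ‖m‖ ^ 2 + inner ℝ h m + s - inner ℝ h (magnetization ν) -
        β / 2 * ∫ S, inner ℝ (S 0 : E) (weightedAverage J S) ∂ν ≤
      cumulantGF μ₀ c - inner ℝ c (magnetization ν) := by
  choose b hb using fun n : ℕ =>
    exists_tiltedMean_near hΩ μ₀ hs (Nat.one_div_pos_of_nat (α := ℝ) (n := n))
  have hmean : Tendsto (fun n => tiltedMean μ₀ (b n)) atTop (𝓝 m) := by
    rw [tendsto_iff_norm_sub_tendsto_zero]
    exact squeeze_zero (fun _ => norm_nonneg _) (fun n => (hb n).1.le)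
      tendsto_one_div_add_atTop_nhds_zero_nat
  have hcont : Continuous fun x : E => β / 2 * ‖x‖ ^ 2 + inner ℝ h x + s -
      inner ℝ h (magnetization ν) - β / 2 * ∫ S, inner ℝ (S 0 : E) (weightedAverage J S) ∂ν := by
    fun_prop
  refine le_of_tendsto' ((hcont.tendsto m).comp hmean) fun n => ?_
  have := infinite_volume_comparison hΩ μ₀ hJ hT hβ h (b n) c hν hνT
  have := (hb n).2
  simp only [Function.comp_apply]
  linarith

end Comparison

end SpinModel

/-! ### The theorem in extended reals. -/

theorem theorem4p1 {E : Type*} [NormedAddCommGroup E] [InnerProductSpace ℝ E]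
    [FiniteDimensional ℝ E] [MeasurableSpace E] [BorelSpace E]
    (Ω : Set E) (hΩ : IsCompact Ω)
    (μ₀ : MeasureTheory.Measure Ω) [MeasureTheory.IsProbabilityMeasure μ₀]
    (d : ℕ) (J : SpinModel.Site d → SpinModel.Site d → ℝ)
    (hJ : SpinModel.IsNormalizedCoupling J)
    (hJtrans : SpinModel.CouplingTranslationInvariant J)
    (hJrot : SpinModel.CouplingRotationInvariant J)
    (β : ℝ) (hβ : 0 ≤ β) (h : E)
    (ν : MeasureTheory.Measure (SpinModel.Config d Ω))
    (hν : SpinModel.IsGibbsMeasure μ₀ J β h ν)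
    (hνtrans : SpinModel.TranslationInvariant ν)
    (hνrot : SpinModel.RotationInvariant ν) :
    SpinModel.freeEnergy μ₀ β h (SpinModel.magnetization ν) ≤
      (⨅ m ∈ convexHull ℝ Ω, SpinModel.freeEnergy μ₀ β h m) +
        ((β / 2 * ((∫ S, inner ℝ (S 0 : E) (SpinModel.weightedAverage J S) ∂ν) -
          ‖SpinModel.magnetization ν‖ ^ 2) : ℝ) : EReal) := by
  -- The correction is finite, so it can be moved to the left and the infimum treated one m at a
  -- time.
  rw [← EReal.sub_le_iff_le_add (Or.inl (EReal.coe_ne_bot _)) (Or.inl (EReal.coe_ne_top _))]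
  refine le_iInf₂ fun m _ => ?_
  induction hent : SpinModel.entropy μ₀ m using EReal.rec with
  | bot =>
    refine le_top.trans_eq ?_
    rw [SpinModel.freeEnergy, hent, EReal.coe_sub_bot]
  | coe s =>
    have hs : ∀ b, s ≤ SpinModel.cumulantGF μ₀ b - inner ℝ b m := fun b =>
      EReal.coe_le_coe_iff.1 (hent.symm.le.trans (iInf_le _ b))
    -- Infimum over c of the comparison; it also shows that the entropy at m⋆ is not -∞.
    have hstar : ((β / 2 * ‖m‖ ^ 2 + inner ℝ h m + s - inner ℝ h (SpinModel.magnetization ν) -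
        β / 2 * ∫ S, inner ℝ (S 0 : E) (SpinModel.weightedAverage J S) ∂ν : ℝ) : EReal) ≤
        SpinModel.entropy μ₀ (SpinModel.magnetization ν) :=
      le_iInf fun c => EReal.coe_le_coe_iff.2
        (SpinModel.entropy_magnetization_ge hΩ μ₀ hJ hJtrans hβ h m c hs hν hνtrans)
    refine (EReal.sub_le_sub (EReal.sub_le_sub le_rfl hstar) le_rfl).trans ?_
    rw [SpinModel.freeEnergy, hent]
    simp only [← EReal.coe_sub]
    exact EReal.coe_le_coe_iff.2 (by linarith)
  | top =>
    -- The field b = 0 already gives a finite upper bound on the entropy.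
    have : SpinModel.entropy μ₀ m ≤ _ := iInf_le _ 0
    rw [hent, top_le_iff] at this
    exact (EReal.coe_ne_top _ this).elim
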